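/- Let $X$ be a real locally convex Hausdorff topological vector space with dual $X^*$. Let $\Gamma(X)$ be the class of proper lower semicontinuous convex functions $h:X\to\mathbb{R}\cup\{+\infty\}$; write $\operatorname{dom}h=\{x: h(x)<+\infty\}$ and $[h\le r]=\{x:h(x)\le r\}$. The recession function $h_\infty$ of $h\in\Gamma(X)$ is the function whose epigraph is the recession cone $\{d:\operatorname{epi}h+\mathbb{R}_+d\subset\operatorname{epi}h\}$ of $\operatorname{epi}h$. A function $h$ is weakly inf-locally compact if $[h\le r]$ is locally compact for the weak topology $\sigma(X,X^*)$ for every $r\in\mathbb{R}$. Let $f\in\Gamma(X)$ and $f_t\in\Gamma(X)$ for $t\in T$, let $E=\bigcap_{t\in T}[f_t\le 0]$, and consider the problem $$(\mathrm{P})\qquad \inf\{f(x): x\in X,\ f_t(x)\le 0\ \ \forall t\in T\},$$ where $E\cap\operatorname{dom}f\neq\emptyset$. Put $(\mathrm{P})_\infty=\bigcap_{t\in T}[(f_t)_\infty\le 0]\cap[f_\infty\le 0]$, and use the convention $0\cdot(+\infty)=0$. Assume that (a) $\operatorname{dom}f\subset\bigcap_{t\in T}\operatorname{dom}f_t$;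 (b) $T$ is a convex and compact subset of some (real) locally convex topological vector space; (c) for each $x\in\bigcap_{t\in T}\operatorname{dom}f_t$ the function $t\mapsto f_t(x)$ is concave and upper semicontinuous on $T$; (d) there exists $(\bar t,\bar\mu)\in T\times\mathbb{R}_+$ such that $f+\bar\mu f_{\bar t}$ is weakly inf-locally compact; (e) $(\mathrm{P})_\infty$ is a linear subspace of $X$. Then $(\mathrm{P})$ attains its infimum, and $$\min(\mathrm{P})=\sup_{(t,\mu)\in T\times\mathbb{R}_+}\ \inf_{x\in X}\{f(x)+\mu f_t(x)\}\in\mathbb{R}.$$ -/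

import Mathlib

open scoped NNReal

namespace ReverseDuality

/-- The epigraph of `h : X → [-∞, +∞]`, as a subset of `X × ℝ`. -/
def epi {X : Type*} (h : X → EReal) : Set (X × ℝ) :=
  {p | h p.1 ≤ (p.2 : EReal)}

/-- The effective domain of `h`. -/
def effDom {X : Type*} (h : X → EReal) : Set X :=
  {x | h x < ⊤}

/-- `h` is proper: its epigraph is non-empty and it never takes the value `-∞`. -/
def IsProper {X : Type*} (h : X → EReal) : Prop :=
  (epi h).Nonempty ∧ ∀ x, h x ≠ ⊥

/-- `h` belongs to `Γ(X)`: it is proper, convex (convex epigraph) and lower semicontinuous. -/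
structure IsGamma {X : Type*} [AddCommGroup X] [Module ℝ X] [TopologicalSpace X]
    (h : X → EReal) : Prop where
  proper : IsProper h
  convex : Convex ℝ (epi h)
  lsc : LowerSemicontinuous h

/-- `φ : Z → [-∞, +∞]` is concave on the set `T`: the hypograph of its restriction to `T`
is convex. -/
def IsConcaveOn {Z : Type*} [AddCommGroup Z] [Module ℝ Z] (T : Set Z) (φ : Z → EReal) : Prop :=
  Convex ℝ {p : Z × ℝ | p.1 ∈ T ∧ (p.2 : EReal) ≤ φ p.1}

/-- The recession cone `A_∞` of a (closed convex) set `A`: the directions `d` with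
`A + ℝ₊ d ⊆ A`. -/
def recessionCone {V : Type*} [AddCommGroup V] [Module ℝ V] (A : Set V) : Set V :=
  {d | ∀ a ∈ A, ∀ s : ℝ, 0 ≤ s → a + s • d ∈ A}

/-- The recession function `h_∞` of `h`, i.e. the function whose epigraph is the recession cone
of the epigraph of `h` (see `epi_recessionFun`). -/
noncomputable def recessionFun {X : Type*} [AddCommGroup X] [Module ℝ X] (h : X → EReal) :
    X → EReal :=
  fun d => sInf ((fun r : ℝ => (r : EReal)) '' {r : ℝ | (d, r) ∈ recessionCone (epi h)})

theorem epi_recessionFun {X : Type*} [AddCommGroup X] [Module ℝ X] (h : X → EReal) :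
    epi (recessionFun h) = recessionCone (epi h) := by
  ext ⟨d, r⟩
  constructor
  · intro hd
    rintro ⟨x, α⟩ hx s hs
    have key : ∀ ε : ℝ, 0 < ε → h (x + s • d) ≤ ((α + s * (r + ε) : ℝ) : EReal) := by
      intro ε hε
      have hlt : recessionFun h d < ((r + ε : ℝ) : EReal) :=
        lt_of_le_of_lt hd (EReal.coe_lt_coe_iff.mpr (by simpa using hε))
      obtain ⟨_, ⟨r', hr', rfl⟩, hlt'⟩ := sInf_lt_iff.mp hlt
      have h1 : h (x + s • d) ≤ ((α + s * r' : ℝ) : EReal) := by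
        simpa [epi] using hr' (x, α) hx s hs
      have h2 : r' ≤ r + ε := (EReal.coe_lt_coe_iff.mp hlt').le
      exact h1.trans (EReal.coe_le_coe_iff.mpr (by gcongr))
    have goal : h (x + s • d) ≤ ((α + s * r : ℝ) : EReal) := by
      refine EReal.le_of_forall_lt_iff_le.mp ?_
      intro z hz
      have hz' : α + s * r < z := EReal.coe_lt_coe_iff.mp hz
      have hs1 : 0 < s + 1 := by linarith
      refine (key ((z - (α + s * r)) / (s + 1)) (div_pos (by linarith) hs1)).trans
        (EReal.coe_le_coe_iff.mpr ?_)
      have h3 : s * ((z - (α + s * r)) / (s + 1)) ≤ z - (α + s * r) := by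
        rw [mul_div_assoc', div_le_iff₀ hs1]
        nlinarith
      linarith
    simpa [epi] using goal
  · intro hd
    have hmem : (r : EReal) ∈ (fun r : ℝ => (r : EReal)) ''
        {r : ℝ | (d, r) ∈ recessionCone (epi h)} := ⟨r, hd, rfl⟩
    exact sInf_le hmem

/-- `h` is weakly inf-locally compact: each sublevel set `[h ≤ r]`, `r ∈ ℝ`, is locally compact
for the weak topology `σ(X, X*)`. -/
def WeaklyInfLocallyCompact {X : Type*} [AddCommGroup X] [Module ℝ X] [TopologicalSpace X]
    (h : X → EReal) : Prop :=
  ∀ r : ℝ, LocallyCompactSpace ↥(toWeakSpace ℝ X '' {x | h x ≤ (r : EReal)})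

/-- The feasible set `E = ⋂_{t ∈ T} [f_t ≤ 0]`. -/
def feasibleSet {X Z : Type*} (T : Set Z) (g : Z → X → EReal) : Set X :=
  {x | ∀ t ∈ T, g t x ≤ 0}

/-- The recession cone of the problem:
`(P)_∞ = ⋂_{t ∈ T} [(f_t)_∞ ≤ 0] ∩ [f_∞ ≤ 0]`. -/
def problemRecessionCone {X Z : Type*} [AddCommGroup X] [Module ℝ X]
    (f : X → EReal) (T : Set Z) (g : Z → X → EReal) : Set X :=
  {d | (∀ t ∈ T, recessionFun (g t) d ≤ 0) ∧ recessionFun f d ≤ 0}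

/-- The Lagrangian `f + μ f_t`; in `EReal` one has `0 * ⊤ = 0`. -/
noncomputable def lagrangian {X Z : Type*} (f : X → EReal) (g : Z → X → EReal)
    (t : Z) (μ : ℝ≥0) : X → EReal :=
  fun x => f x + ((μ : ℝ) : EReal) * g t x

end ReverseDuality

/-!
For `c` the dual value, consider the sublevel sets `{f + μ f_t ≤ α}` with `t ∈ T`, `μ ≥ 0` and real
`α > c`. Letting `μ → ∞` and `α → c` shows that their common points are the feasible `x` with
`f x ≤ c`, which by weak duality are solutions of the problem with value `c`; the same argument
along half-lines shows that their common recession cone is `(P)_∞`. They have the finite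
intersection property: otherwise a convex alternative produces a convex combination of finitely
many Lagrangians lying above some `α > c`, and concavity in `t` replaces the averaged constraint by
a single `f_t`, contradicting the definition of `c`.

It remains to intersect infinitely many closed convex sets, one of them weakly locally compact, when
the common recession cone is a subspace `L`. Then `L` is finite-dimensional, and cutting with a
closed complement reduces to `L = 0`. By local compactness, finitely many of the recession cones
already have a compact, hence trivial, intersection; so the corresponding sets have a compact
intersection, and compactness concludes.
-/

namespace ReverseDuality

open Set Filter Topology

section RecessionCone

variable {V W : Type*} [AddCommGroup V] [Module ℝ V] [AddCommGroup W] [Module ℝ W]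

theorem recessionCone_image (e : V ≃ₗ[ℝ] W) (A : Set V) :
    recessionCone (e '' A) = e '' recessionCone A := by
  ext d
  obtain ⟨d, rfl⟩ := e.surjective d
  simp only [recessionCone, forall_mem_image, mem_ofPred_eq, ← map_smul, ← map_add,
    e.injective.mem_set_image]

variable [TopologicalSpace V] [IsTopologicalAddGroup V] [ContinuousSMul ℝ V]

theorem mem_asymptoticCone_of_forall_nat {A : Set V} {a d : V}
    (hd : ∀ n : ℕ, a + (n : ℝ) • d ∈ A) : d ∈ asymptoticCone ℝ A :=
  (((tendsto_natCast_atTop_atTop (R := ℝ)).atTop_smul_const_tendsto_asymptoticNhds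
    d).asymptoticNhds_vadd_const a).frequently <| .of_forall fun n => by
      simpa only [vadd_eq_add, add_comm] using hd n

theorem recessionCone_eq_asymptoticCone {A : Set V} (hA : Convex ℝ A) (hclosed : IsClosed A)
    (hne : A.Nonempty) : recessionCone A = asymptoticCone ℝ A := by
  obtain ⟨a, ha⟩ := hne
  refine Subset.antisymm (fun d hd => ?_) fun d hd x hx s hs => ?_
  · exact mem_asymptoticCone_of_forall_nat fun n => hd a ha n n.cast_nonneg
  · simpa only [vadd_eq_add, add_comm] using
      hA.smul_vadd_mem_of_isClosed_of_mem_asymptoticCone hclosed hs hd hx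

end RecessionCone

section LocallyCompact

variable {V ι : Type*} [AddCommGroup V] [TopologicalSpace V] [IsTopologicalAddGroup V]

theorem locallyCompactSpace_of_forall_add_mem {A C : Set V} [LocallyCompactSpace A]
    (hC : IsClosed C) (a : V) (h : ∀ d ∈ C, a + d ∈ A) : LocallyCompactSpace C := by
  have hsub : Homeomorph.addLeft a '' C ⊆ A := image_subset_iff.2 h
  have hclosed : IsClosed (Homeomorph.addLeft a '' C) :=
    (Homeomorph.addLeft a).isClosed_image.2 hC
  exact ((IsClosedEmbedding.inclusion hsub (hclosed.preimage continuous_subtype_val)).comp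
    ((Homeomorph.addLeft a).image C).isClosedEmbedding).locallyCompactSpace

variable [Module ℝ V] [ContinuousSMul ℝ V] [T2Space V]

theorem exists_finset_isCompact_biInter {C : ι → Set V} (hclosed : ∀ i, IsClosed (C i))
    (hconvex : ∀ i, Convex ℝ (C i)) {x₀ : V} (hx₀ : ⋂ i, C i = {x₀}) (i₀ : ι)
    [LocallyCompactSpace (C i₀)] : ∃ F : Finset ι, IsCompact (⋂ i ∈ F, C i) := by
  classical
  have hmem : ∀ i, x₀ ∈ C i := mem_iInter.1 (hx₀ ▸ mem_singleton x₀)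
  obtain ⟨K', hK', hK'x⟩ := exists_compact_mem_nhds (⟨x₀, hmem i₀⟩ : C i₀)
  obtain ⟨N, hN, hNK⟩ := mem_nhds_subtype _ _ _ |>.1 hK'x
  obtain ⟨W, hWN, hW, hx₀W⟩ := mem_nhds_iff.1 hN
  set K : Set V := (↑) '' K'
  have hK : IsCompact K := hK'.image continuous_subtype_val
  have hWK : W ∩ C i₀ ⊆ K := fun x hx => ⟨⟨x, hx.2⟩, hNK (hWN hx.1), rfl⟩
  obtain ⟨u, hu⟩ := (hK.diff hW).elim_finite_subfamily_closed C hclosed <| by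
    rw [hx₀, inter_singleton_eq_empty]
    exact fun h => h.2 hx₀W
  let F := insert i₀ u
  have hFi₀ : ⋂ i ∈ F, C i ⊆ C i₀ := biInter_subset_of_mem (Finset.mem_insert_self i₀ u)
  have hFu : ⋂ i ∈ F, C i ⊆ ⋂ i ∈ u, C i := biInter_subset_biInter_left (Finset.subset_insert i₀ u)
  -- The connected set `⋂ i ∈ F, C i` is covered by `W` and `Kᶜ`, disjoint on it, and meets `W`.
  have hFW : ⋂ i ∈ F, C i ⊆ W := by
    have hcover : ⋂ i ∈ F, C i ⊆ W ∪ Kᶜ := fun x hx => by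
      by_contra! hx'
      rw [mem_union, not_or, notMem_compl_iff] at hx'
      exact hu.subset ⟨⟨hx'.2, hx'.1⟩, hFu hx⟩
    have hdisj : (⋂ i ∈ F, C i) ∩ (W ∩ Kᶜ) = ∅ :=
      eq_empty_of_forall_notMem fun x hx => hx.2.2 (hWK ⟨hx.2.1, hFi₀ hx.1⟩)
    refine (isPreconnected_iff_subset_of_disjoint.1
      (convex_iInter₂ fun i _ => hconvex i).isPreconnected W Kᶜ hW hK.isClosed.isOpen_compl
      hcover hdisj).resolve_right fun h => ?_
    exact h (mem_iInter₂.2 fun i _ => hmem i) (hWK ⟨hx₀W, hmem i₀⟩)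
  exact ⟨F, hK.of_isClosed_subset (isClosed_biInter fun i _ => hclosed i) fun x hx =>
    hWK ⟨hFW hx, hFi₀ hx⟩⟩

theorem subset_zero_of_isCompact_of_smul_mem {K : Set V} (hK : IsCompact K)
    (hsmul : ∀ x ∈ K, ∀ c : ℝ, 0 ≤ c → c • x ∈ K) : K ⊆ {0} := by
  intro x hx
  have hlim : Tendsto (fun n : ℕ => ((n : ℝ) + 1)⁻¹ • ((n : ℝ) + 1) • x) atTop (𝓝 0) :=
    (hK.isVonNBounded ℝ).smul_tendsto_zero (.of_forall fun n => hsmul x hx _ (by positivity))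
      (by simpa using tendsto_one_div_add_atTop_nhds_zero_nat (𝕜 := ℝ))
  have hconst : ∀ n : ℕ, ((n : ℝ) + 1)⁻¹ • ((n : ℝ) + 1) • x = x := fun n =>
    inv_smul_smul₀ (by positivity) x
  simp only [hconst] at hlim
  exact tendsto_nhds_unique tendsto_const_nhds hlim

theorem isCompact_of_asymptoticCone_subset_zero {A : Set V} (hclosed : IsClosed A)
    (hconvex : Convex ℝ A) [LocallyCompactSpace A] (hcone : asymptoticCone ℝ A ⊆ {0}) :
    IsCompact A := by
  obtain rfl | ⟨a, ha⟩ := A.eq_empty_or_nonempty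
  · exact isCompact_empty
  -- The contractions of `A` towards `a` shrink to `{a}`, so one of them is compact.
  let C : ℕ → Set V := fun n => AffineMap.homothety a (n : ℝ) ⁻¹' A
  have hC : ⋂ n, C n = {a} := by
    refine Subset.antisymm (fun x hx => ?_) (by simpa [C] using ha)
    have hray : x - a ∈ asymptoticCone ℝ A := mem_asymptoticCone_of_forall_nat (a := a) fun n => by
      simpa [C, AffineMap.homothety_apply, add_comm] using mem_iInter.1 hx n
    exact sub_eq_zero.1 (hcone hray)
  have hC₁ : C 1 = A := by simp [C]
  have : LocallyCompactSpace (C 1) := by rwa [hC₁]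
  obtain ⟨F, hF⟩ := exists_finset_isCompact_biInter (C := C)
    (fun n => hclosed.preimage (AffineMap.homothety_continuous a (n : ℝ)))
    (fun n => hconvex.affine_preimage _) hC 1
  let N : ℕ := F.sup id + 1
  have hN : (N : ℝ) ≠ 0 := by positivity
  refine (hF.image (AffineMap.homothety_continuous a (N : ℝ))).of_isClosed_subset hclosed
    fun x hx => ⟨AffineMap.homothety a (N : ℝ)⁻¹ x, mem_iInter₂.2 fun n hn => ?_, ?_⟩
  · have hnN : (n : ℝ) ≤ N := by exact_mod_cast (Finset.le_sup (f := id) hn).trans (Nat.le_succ _)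
    rw [mem_preimage, ← AffineMap.homothety_mul_apply, AffineMap.homothety_eq_lineMap]
    exact hconvex.lineMap_mem ha hx
      ⟨by positivity, by rw [← div_eq_mul_inv]; exact div_le_one_of_le₀ hnN N.cast_nonneg⟩
  · rw [← AffineMap.homothety_mul_apply, mul_inv_cancel₀ hN, AffineMap.homothety_one,
      AffineMap.id_apply]

theorem exists_finset_isCompact_biInter_of_asymptoticCone {A : ι → Set V}
    (hclosed : ∀ i, IsClosed (A i)) (hconvex : ∀ i, Convex ℝ (A i)) (hne : ∀ i, (A i).Nonempty)
    (i₀ : ι) [LocallyCompactSpace (A i₀)] (hcone : ⋂ i, asymptoticCone ℝ (A i) ⊆ {0}) :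
    ∃ F : Finset ι, IsCompact (⋂ i ∈ F, A i) := by
  classical
  obtain ⟨a, ha⟩ := hne i₀
  have : LocallyCompactSpace (asymptoticCone ℝ (A i₀)) :=
    locallyCompactSpace_of_forall_add_mem (A := A i₀) isClosed_asymptoticCone a fun d hd => by
      rw [← recessionCone_eq_asymptoticCone (hconvex i₀) (hclosed i₀) (hne i₀)] at hd
      simpa using hd a ha 1 zero_le_one
  obtain ⟨u, hu⟩ := exists_finset_isCompact_biInter (C := fun i => asymptoticCone ℝ (A i))
    (x₀ := 0) (fun i => isClosed_asymptoticCone) (fun i => (hconvex i).asymptoticCone)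
    (hcone.antisymm <| singleton_subset_iff.2 <| mem_iInter.2 fun i =>
      zero_mem_asymptoticCone.2 (hne i)) i₀
  have hu₀ : ⋂ i ∈ u, asymptoticCone ℝ (A i) ⊆ {0} :=
    subset_zero_of_isCompact_of_smul_mem hu fun x hx c hc => mem_iInter₂.2 fun i hi =>
      smul_mem_asymptoticCone hc (mem_iInter₂.1 hx i hi)
  let F := insert i₀ u
  have hFclosed : IsClosed (⋂ i ∈ F, A i) := isClosed_biInter fun i _ => hclosed i
  have : LocallyCompactSpace ↥(⋂ i ∈ F, A i) :=
    locallyCompactSpace_of_forall_add_mem (A := A i₀) hFclosed 0 fun x hx => by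
      simpa using mem_iInter₂.1 hx i₀ (Finset.mem_insert_self i₀ u)
  have hFconvex : Convex ℝ (⋂ i ∈ F, A i) := convex_iInter₂ fun i _ => hconvex i
  refine ⟨F, isCompact_of_asymptoticCone_subset_zero hFclosed hFconvex ?_⟩
  have hFcone : asymptoticCone ℝ (⋂ i ∈ F, A i) ⊆ ⋂ i ∈ u, asymptoticCone ℝ (A i) :=
    subset_iInter₂ fun i hi => asymptoticCone_mono <|
      biInter_subset_of_mem (Finset.mem_insert_of_mem hi)
  exact hFcone.trans hu₀

theorem nonempty_iInter_of_iInter_asymptoticCone_subset_zero {A : ι → Set V}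
    (hclosed : ∀ i, IsClosed (A i)) (hconvex : ∀ i, Convex ℝ (A i))
    (hfip : ∀ F : Finset ι, (⋂ i ∈ F, A i).Nonempty) (i₀ : ι) [LocallyCompactSpace (A i₀)]
    (hcone : ⋂ i, asymptoticCone ℝ (A i) ⊆ {0}) : (⋂ i, A i).Nonempty := by
  classical
  obtain ⟨F, hF⟩ := exists_finset_isCompact_biInter_of_asymptoticCone hclosed hconvex
    (fun i => by simpa using hfip {i}) i₀ hcone
  exact (hF.inter_iInter_nonempty A hclosed fun G => by
    simpa only [Finset.mem_union, iInter_or, iInter_inter_distrib] using hfip (F ∪ G)).mono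
      inter_subset_right

theorem finiteDimensional_of_forall_add_mem (L : Submodule ℝ V) (hL : IsClosed (L : Set V))
    {A : Set V} [LocallyCompactSpace A] {a : V} (h : ∀ d ∈ L, a + d ∈ A) :
    FiniteDimensional ℝ L := by
  have : LocallyCompactSpace (L : Set V) := locallyCompactSpace_of_forall_add_mem hL a h
  exact .of_locallyCompactSpace ℝ

theorem nonempty_iInter_of_iInter_asymptoticCone_eq [LocallyConvexSpace ℝ V] {A : ι → Set V}
    (hclosed : ∀ i, IsClosed (A i)) (hconvex : ∀ i, Convex ℝ (A i))
    (hfip : ∀ F : Finset ι, (⋂ i ∈ F, A i).Nonempty) (i₀ : ι) [LocallyCompactSpace (A i₀)]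
    (L : Submodule ℝ V) (hL : (L : Set V) = ⋂ i, asymptoticCone ℝ (A i)) :
    (⋂ i, A i).Nonempty := by
  have hadd : ∀ i, ∀ x ∈ A i, ∀ d ∈ L, x + d ∈ A i := fun i x hx d hd => by
    have hdi : d ∈ asymptoticCone ℝ (A i) := mem_iInter.1 (hL.subset hd) i
    rw [← recessionCone_eq_asymptoticCone (hconvex i) (hclosed i) ⟨x, hx⟩] at hdi
    simpa using hdi x hx 1 zero_le_one
  obtain ⟨a, ha⟩ : (A i₀).Nonempty := by simpa using hfip {i₀}
  have hLclosed : IsClosed (L : Set V) := hL ▸ isClosed_iInter fun i => isClosed_asymptoticCone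
  have := finiteDimensional_of_forall_add_mem L hLclosed (hadd i₀ a ha)
  obtain ⟨P, hP⟩ := Submodule.ClosedComplemented.of_finiteDimensional (𝕜 := ℝ) L
  let H : Submodule ℝ V := P.ker
  have hH : IsClosed (H : Set V) := P.isClosed_ker
  have hproj : ∀ x, x - P x ∈ H := fun x => by simp [H, hP]
  let B : ι → Set V := fun i => A i ∩ H
  have hBclosed : ∀ i, IsClosed (B i) := fun i => (hclosed i).inter hH
  have hBfip : ∀ F : Finset ι, (⋂ i ∈ F, B i).Nonempty := fun F => by
    obtain ⟨x, hx⟩ := hfip F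
    refine ⟨x - P x, mem_iInter₂.2 fun i hi => ⟨?_, hproj x⟩⟩
    simpa [sub_eq_add_neg] using hadd i x (mem_iInter₂.1 hx i hi) _ (L.neg_mem (P x).2)
  have : LocallyCompactSpace (B i₀) :=
    locallyCompactSpace_of_forall_add_mem (A := A i₀) (hBclosed i₀) 0 fun x hx => by
      simpa using hx.1
  have hBcone : ⋂ i, asymptoticCone ℝ (B i) ⊆ {0} := fun d hd => by
    rw [mem_iInter] at hd
    have hdL : d ∈ L := hL.superset <| mem_iInter.2 fun i =>
      asymptoticCone_mono inter_subset_left (hd i)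
    have hdH : d ∈ (H : Set V) := by
      simpa only [asymptoticCone_submodule, hH.closure_eq] using
        asymptoticCone_mono (k := ℝ) (inter_subset_right (s := A i₀)) (hd i₀)
    exact congrArg Subtype.val ((hP ⟨d, hdL⟩).symm.trans hdH)
  exact (nonempty_iInter_of_iInter_asymptoticCone_subset_zero hBclosed
    (fun i => (hconvex i).inter H.convex) hBfip i₀ hBcone).mono
      (iInter_mono fun i => inter_subset_left)

end LocallyCompact

section WeakTopology

variable {X : Type*} [AddCommGroup X] [Module ℝ X] [TopologicalSpace X] [IsTopologicalAddGroup X]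
  [ContinuousSMul ℝ X] [LocallyConvexSpace ℝ X]

theorem isClosed_image_toWeakSpace {C : Set X} (hconvex : Convex ℝ C) (hclosed : IsClosed C) :
    IsClosed (toWeakSpace ℝ X '' C) := by
  rw [← hclosed.closure_eq, hconvex.toWeakSpace_closure ℝ]
  exact isClosed_closure

theorem nonempty_iInter_of_iInter_recessionCone_eq [T2Space X] {ι : Type*} {A : ι → Set X}
    (hclosed : ∀ i, IsClosed (A i)) (hconvex : ∀ i, Convex ℝ (A i))
    (hfip : ∀ F : Finset ι, (⋂ i ∈ F, A i).Nonempty) (i₀ : ι)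
    [LocallyCompactSpace ↥(toWeakSpace ℝ X '' A i₀)] (L : Submodule ℝ X)
    (hL : (L : Set X) = ⋂ i, recessionCone (A i)) : (⋂ i, A i).Nonempty := by
  let e := toWeakSpace ℝ X
  have : LocallyConvexSpace ℝ (WeakSpace ℝ X) :=
    WeakBilin.locallyConvexSpace (B := (topDualPairing ℝ X).flip)
  have hAclosed : ∀ i, IsClosed (e '' A i) := fun i =>
    isClosed_image_toWeakSpace (hconvex i) (hclosed i)
  have hAconvex : ∀ i, Convex ℝ (e '' A i) := fun i => (hconvex i).linear_image e.toLinearMap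
  have hAcone : ∀ i, asymptoticCone ℝ (e '' A i) = e '' recessionCone (A i) := fun i => by
    have hne : (A i).Nonempty := by simpa using hfip {i}
    rw [← recessionCone_eq_asymptoticCone (hAconvex i) (hAclosed i) (hne.image e),
      recessionCone_image]
  obtain ⟨y, hy⟩ := nonempty_iInter_of_iInter_asymptoticCone_eq hAclosed hAconvex
    (fun F => by simpa only [image_iInter e.bijective] using (hfip F).image e) i₀
    (L.map e.toLinearMap) (by
      simp only [hAcone, ← image_iInter e.bijective, ← hL]
      rfl)
  rw [← image_iInter e.bijective] at hy
  exact image_nonempty.1 ⟨y, hy⟩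

end WeakTopology

section Alternative

variable {κ : Type*} [Fintype κ]

theorem exists_stdSimplex_forall_sum_nonneg {C : Set (κ → ℝ)} (hC : Convex ℝ C)
    (hne : C.Nonempty) (h : ∀ u ∈ C, ∃ k, 0 ≤ u k) :
    ∃ w ∈ stdSimplex ℝ κ, ∀ u ∈ C, 0 ≤ ∑ k, w k * u k := by
  classical
  let U : Set (κ → ℝ) := univ.pi fun _ => Iio 0
  have hdisj : Disjoint U C := Set.disjoint_left.2 fun u hu huC =>
    let ⟨k, hk⟩ := h u huC
    hk.not_gt (hu k trivial)
  obtain ⟨ℓ, c, hℓU, hℓC⟩ := geometric_hahn_banach_open (convex_pi fun _ _ => convex_Iio 0)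
    (isOpen_set_pi finite_univ fun _ _ => isOpen_Iio) hC hdisj
  have hℓ_le : ∀ u ≤ 0, ℓ u ≤ c := fun u hu =>
    le_on_closure (fun v hv => (hℓU v hv).le) ℓ.continuous.continuousOn continuousOn_const <| by
      rw [closure_pi_set]
      exact fun k _ => closure_Iio (0 : ℝ) ▸ hu k
  have hc : 0 ≤ c := by simpa using hℓ_le 0 le_rfl
  let v : κ → ℝ := fun k => ℓ (Pi.single k 1)
  have hℓ : ∀ u, ℓ u = ∑ k, v k * u k := fun u => by
    conv_lhs => rw [pi_eq_sum_univ' u]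
    simp [v, mul_comm]
  have hv : ∀ k, 0 ≤ v k := fun k => by
    by_contra! hk
    obtain ⟨n, hn⟩ := exists_nat_gt (c / -v k)
    have hneg : ℓ (-((n : ℝ) • Pi.single k 1)) ≤ c :=
      hℓ_le _ <| neg_nonpos.2 <| smul_nonneg n.cast_nonneg <| Pi.single_nonneg.2 zero_le_one
    rw [div_lt_iff₀ (neg_pos.2 hk)] at hn
    rw [map_neg, map_smul, smul_eq_mul] at hneg
    linarith
  have hpos : 0 < ∑ k, v k := by
    obtain ⟨u, hu⟩ := hne
    refine (Finset.sum_nonneg fun k _ => hv k).lt_of_ne' fun h0 => ?_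
    have hv0 : ∀ k, v k = 0 := by
      simpa using (Finset.sum_eq_zero_iff_of_nonneg fun k _ => hv k).1 h0
    have hlt : ℓ (fun _ => -1) < ℓ u := (hℓU _ fun _ _ => by simp).trans_le (hℓC u hu)
    simp [hℓ, hv0] at hlt
  refine ⟨fun k => v k / ∑ j, v j, ⟨fun k => div_nonneg (hv k) hpos.le, ?_⟩, fun u hu => ?_⟩
  · rw [← Finset.sum_div, div_self hpos.ne']
  · simp only [div_mul_eq_mul_div, ← Finset.sum_div, ← hℓ]
    exact div_nonneg (hc.trans (hℓC u hu)) hpos.le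

theorem exists_stdSimplex_forall_sum_mul_nonneg_of_convexOn {V : Type*} [AddCommGroup V]
    [Module ℝ V] {S : Set V} {φ : V → κ → ℝ} (hφ : ConvexOn ℝ S φ) (hS : S.Nonempty)
    (h : ∀ x ∈ S, ∃ k, 0 ≤ φ x k) : ∃ w ∈ stdSimplex ℝ κ, ∀ x ∈ S, 0 ≤ ∑ k, w k * φ x k := by
  let C : Set (κ → ℝ) := Prod.snd '' {p : V × (κ → ℝ) | p.1 ∈ S ∧ φ p.1 ≤ p.2}
  have hmem : ∀ x ∈ S, φ x ∈ C := fun x hx => ⟨(x, φ x), ⟨hx, le_rfl⟩, rfl⟩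
  have hC : Convex ℝ C := hφ.convex_epigraph.linear_image (LinearMap.snd ℝ V (κ → ℝ))
  obtain ⟨x₀, hx₀⟩ := hS
  obtain ⟨w, hw, hwC⟩ := exists_stdSimplex_forall_sum_nonneg hC ⟨φ x₀, hmem x₀ hx₀⟩ <| by
    rintro _ ⟨⟨x, u⟩, ⟨hx, hxu⟩, rfl⟩
    obtain ⟨k, hk⟩ := h x hx
    exact ⟨k, hk.trans (hxu k)⟩
  exact ⟨w, hw, fun x hx => hwC _ (hmem x hx)⟩

theorem exists_mem_forall_sum_mul_le_of_concaveOn {Z ι : Type*} [AddCommGroup Z] [Module ℝ Z]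
    {T : Set Z} (hT : Convex ℝ T) (hne : T.Nonempty) {G : ι → Z → ℝ}
    (hG : ∀ i, ConcaveOn ℝ T (G i)) {w : κ → ℝ} (hw : ∀ k, 0 ≤ w k) {t : κ → Z}
    (ht : ∀ k, t k ∈ T) : ∃ s ∈ T, ∀ i, ∑ k, w k * G i (t k) ≤ (∑ k, w k) * G i s := by
  obtain h0 | hpos := (Finset.sum_nonneg fun k (_ : k ∈ Finset.univ) => hw k).eq_or_lt
  · obtain ⟨s, hs⟩ := hne
    have hw0 : ∀ k, w k = 0 := by
      simpa using (Finset.sum_eq_zero_iff_of_nonneg fun k _ => hw k).1 h0.symm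
    exact ⟨s, hs, fun i => by simp [hw0]⟩
  · refine ⟨Finset.univ.centerMass w t, hT.centerMass_mem (fun k _ => hw k) hpos fun k _ => ht k,
      fun i => ?_⟩
    have hle := (hG i).le_map_centerMass (fun k _ => hw k) hpos fun k _ => ht k
    rwa [Finset.centerMass, smul_eq_mul, inv_mul_le_iff₀ hpos] at hle

end Alternative

theorem recessionFun_nonpos_iff {X : Type*} [AddCommGroup X] [Module ℝ X] {h : X → EReal} {d : X} :
    recessionFun h d ≤ 0 ↔ ∀ x, ∀ s : ℝ, 0 ≤ s → h (x + s • d) ≤ h x := by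
  have hepi : recessionFun h d ≤ 0 ↔ (d, (0 : ℝ)) ∈ recessionCone (epi h) := by
    rw [← epi_recessionFun, epi, mem_ofPred_eq, EReal.coe_zero]
  rw [hepi]
  refine ⟨fun hd x s hs => EReal.le_of_forall_lt_iff_le.1 fun z hz => ?_,
    fun hd a ha s hs => ?_⟩
  · simpa [epi] using hd (x, z) hz.le s hs
  · simpa [epi] using (hd a.1 s hs).trans ha

section Gamma

variable {X : Type*} [AddCommGroup X] [Module ℝ X] [TopologicalSpace X] {h : X → EReal}

theorem IsGamma.coe_toReal (hh : IsGamma h) {x : X} (hx : x ∈ effDom h) :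
    ((h x).toReal : EReal) = h x :=
  EReal.coe_toReal hx.ne (hh.proper.2 x)

theorem IsGamma.nonempty_effDom (hh : IsGamma h) : (effDom h).Nonempty := by
  obtain ⟨⟨x, r⟩, hr⟩ := hh.proper.1
  exact ⟨x, hr.trans_lt (EReal.coe_lt_top r)⟩

theorem IsGamma.le_add_of_mem_effDom (hh : IsGamma h) {x y : X} (hx : x ∈ effDom h)
    (hy : y ∈ effDom h) {a b : ℝ} (ha : 0 ≤ a) (hb : 0 ≤ b) (hab : a + b = 1) :
    h (a • x + b • y) ≤ ((a * (h x).toReal + b * (h y).toReal : ℝ) : EReal) := by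
  simpa [epi] using hh.convex (x := (x, (h x).toReal)) (hh.coe_toReal hx).ge
    (y := (y, (h y).toReal)) (hh.coe_toReal hy).ge ha hb hab

theorem IsGamma.convex_effDom (hh : IsGamma h) : Convex ℝ (effDom h) :=
  fun _ hx _ hy _ _ ha hb hab =>
    (hh.le_add_of_mem_effDom hx hy ha hb hab).trans_lt (EReal.coe_lt_top _)

theorem IsGamma.convexOn_toReal (hh : IsGamma h) {S : Set X} (hS : Convex ℝ S)
    (hSh : S ⊆ effDom h) : ConvexOn ℝ S fun x => (h x).toReal := by
  refine ⟨hS, fun x hx y hy a b ha hb hab => ?_⟩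
  rw [← EReal.coe_le_coe_iff, hh.coe_toReal (hSh (hS hx hy ha hb hab))]
  exact hh.le_add_of_mem_effDom (hSh hx) (hSh hy) ha hb hab

theorem IsGamma.isClosed_epi (hh : IsGamma h) : IsClosed (epi h) :=
  hh.lsc.isClosed_epigraph.preimage
    (continuous_fst.prodMk (continuous_coe_real_ereal.comp continuous_snd))

theorem IsGamma.recessionFun_nonpos_of_forall_nat [IsTopologicalAddGroup X] [ContinuousSMul ℝ X]
    (hh : IsGamma h) {x d : X} {α : ℝ} (hd : ∀ n : ℕ, h (x + (n : ℝ) • d) ≤ α) :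
    recessionFun h d ≤ 0 := by
  have hmem : (d, (0 : ℝ)) ∈ epi (recessionFun h) := by
    rw [epi_recessionFun,
      recessionCone_eq_asymptoticCone hh.convex hh.isClosed_epi hh.proper.1]
    exact mem_asymptoticCone_of_forall_nat (a := (x, α)) fun n => by simpa [epi] using hd n
  exact hmem

end Gamma

theorem IsConcaveOn.concaveOn_toReal {Z : Type*} [AddCommGroup Z] [Module ℝ Z] {T : Set Z}
    {φ : Z → EReal} (hφ : IsConcaveOn T φ) (hT : Convex ℝ T)
    (hfin : ∀ t ∈ T, ((φ t).toReal : EReal) = φ t) : ConcaveOn ℝ T fun t => (φ t).toReal := by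
  refine ⟨hT, fun s hs t ht a b ha hb hab => ?_⟩
  rw [← EReal.coe_le_coe_iff, hfin _ (hT hs ht ha hb hab)]
  exact (hφ (x := (s, (φ s).toReal)) ⟨hs, (hfin s hs).le⟩
    (y := (t, (φ t).toReal)) ⟨ht, (hfin t ht).le⟩ ha hb hab).2

section Lagrangian

theorem coe_mul_ne_bot (μ : ℝ≥0) {y : EReal} (hy : y ≠ ⊥) : ((μ : ℝ) : EReal) * y ≠ ⊥ :=
  (EReal.mul_ne_bot _ _).2 ⟨.inl (EReal.coe_ne_bot _), .inr hy, .inl (EReal.coe_ne_top _),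
    .inl (EReal.coe_nonneg.2 μ.2)⟩

theorem lagrangian_le {X Z : Type*} {f : X → EReal} {g : Z → X → EReal} {t : Z} {μ : ℝ≥0} {x : X}
    (hx : g t x ≤ 0) : lagrangian f g t μ x ≤ f x := by
  have hμ : ((μ : ℝ) : EReal) * g t x ≤ 0 :=
    EReal.mul_nonpos_iff.2 (.inl ⟨EReal.coe_nonneg.2 μ.2, hx⟩)
  simpa [lagrangian] using add_le_add_right hμ (f x)

theorem lagrangian_eq_top {X Z : Type*} {f : X → EReal} {g : Z → X → EReal} {t : Z} {μ : ℝ≥0}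
    {x : X} (hgx : g t x ≠ ⊥) (hx : x ∉ effDom f) : lagrangian f g t μ x = ⊤ := by
  have hfx : f x = ⊤ := not_lt_top_iff.1 hx
  rw [lagrangian, hfx, EReal.top_add_of_ne_bot (coe_mul_ne_bot μ hgx)]

/-- The dual value `sup_{(t, μ) ∈ T × ℝ₊} inf_x (f x + μ f_t x)` of the problem. -/
noncomputable def dualValue {X Z : Type*} (f : X → EReal) (T : Set Z) (g : Z → X → EReal) :
    EReal :=
  ⨆ p : T × ℝ≥0, ⨅ x, lagrangian f g p.1 p.2 x

theorem iInf_lagrangian_le_dualValue {X Z : Type*} {f : X → EReal} {g : Z → X → EReal} {T : Set Z}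
    {t : Z} (ht : t ∈ T) (μ : ℝ≥0) : ⨅ x, lagrangian f g t μ x ≤ dualValue f T g :=
  le_iSup (fun p : T × ℝ≥0 => ⨅ x, lagrangian f g p.1 p.2 x) (⟨t, ht⟩, μ)

theorem dualValue_le {X Z : Type*} {f : X → EReal} {g : Z → X → EReal} {T : Set Z} {x : X}
    (hx : x ∈ feasibleSet T g) : dualValue f T g ≤ f x :=
  iSup_le fun p => (iInf_le _ x).trans (lagrangian_le (hx p.1 p.1.2))

/-- The sublevel sets of all Lagrangians `f + μ f_t` at the real levels strictly above `c`; a point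
common to all of them is a feasible `x` with `f x ≤ c`. -/
def lagrangianSublevel {X Z : Type*} (f : X → EReal) (T : Set Z) (g : Z → X → EReal) (c : EReal)
    (i : {α : ℝ // c < α} × T × ℝ≥0) : Set X :=
  {x | lagrangian f g i.2.1 i.2.2 x ≤ (i.1 : ℝ)}

variable {X Z : Type*} [AddCommGroup X] [Module ℝ X] [TopologicalSpace X]
  {f : X → EReal} {g : Z → X → EReal} {T : Set Z} {t : Z} {μ : ℝ≥0} {c : EReal}

theorem lagrangian_eq_coe (hf : IsGamma f) (hgt : IsGamma (g t)) (hdom : effDom f ⊆ effDom (g t))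
    {x : X} (hx : x ∈ effDom f) :
    lagrangian f g t μ x = (((f x).toReal + μ * (g t x).toReal : ℝ) : EReal) := by
  rw [lagrangian, ← hf.coe_toReal hx, ← hgt.coe_toReal (hdom hx)]
  simp

theorem convexOn_toReal_add_mul_toReal (hf : IsGamma f) (hgt : IsGamma (g t))
    (hdom : effDom f ⊆ effDom (g t)) :
    ConvexOn ℝ (effDom f) fun x => (f x).toReal + (μ : ℝ) * (g t x).toReal :=
  (hf.convexOn_toReal hf.convex_effDom subset_rfl).add
    ((hgt.convexOn_toReal hf.convex_effDom hdom).smul μ.2)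

theorem convex_lagrangian_le (hf : IsGamma f) (hgt : IsGamma (g t))
    (hdom : effDom f ⊆ effDom (g t)) (α : ℝ) : Convex ℝ {x | lagrangian f g t μ x ≤ α} := by
  have heq : {x | lagrangian f g t μ x ≤ α} =
      {x ∈ effDom f | (f x).toReal + μ * (g t x).toReal ≤ α} := by
    ext x
    by_cases hx : x ∈ effDom f
    · simp only [mem_ofPred_eq, lagrangian_eq_coe hf hgt hdom hx, EReal.coe_le_coe_iff, hx,
        true_and]
    · simp [lagrangian_eq_top (hgt.proper.2 x) hx, hx]
  exact heq ▸ (convexOn_toReal_add_mul_toReal hf hgt hdom).convex_le α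

theorem lowerSemicontinuous_lagrangian (hf : IsGamma f) (hgt : IsGamma (g t)) :
    LowerSemicontinuous (lagrangian f g t μ) := by
  have hmul : LowerSemicontinuous fun x => ((μ : ℝ) : EReal) * g t x := by
    obtain rfl | hμ := eq_or_ne μ 0
    · simpa using lowerSemicontinuous_const
    · have hμ' : ((μ : ℝ) : EReal) ≠ 0 := by simpa using hμ
      have hcont : Continuous fun y : EReal => ((μ : ℝ) : EReal) * y :=
        continuous_iff_continuousAt.2 fun y => EReal.Tendsto.mul tendsto_const_nhds tendsto_id
          (.inl hμ') (.inl hμ') (.inl (EReal.coe_ne_bot _)) (.inl (EReal.coe_ne_top _))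
      exact hcont.comp_lowerSemicontinuous hgt.lsc fun a b hab =>
        mul_le_mul_of_nonneg_left hab (EReal.coe_nonneg.2 μ.2)
  exact hf.lsc.add' hmul fun x =>
    EReal.continuousAt_add (.inr (coe_mul_ne_bot μ (hgt.proper.2 x))) (.inl (hf.proper.2 x))

theorem le_and_nonpos_of_forall_lagrangian_le (hf : IsGamma f) (hgt : IsGamma (g t))
    (hdom : effDom f ⊆ effDom (g t)) {x : X} {α : ℝ}
    (h : ∀ μ : ℝ≥0, lagrangian f g t μ x ≤ α) : f x ≤ α ∧ g t x ≤ 0 := by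
  have h0 : f x ≤ α := by simpa [lagrangian] using h 0
  have hx : x ∈ effDom f := h0.trans_lt (EReal.coe_lt_top _)
  refine ⟨h0, ?_⟩
  rw [← hgt.coe_toReal (hdom hx)]
  by_contra! hpos
  have hpos' : 0 < (g t x).toReal := EReal.coe_pos.1 hpos
  obtain ⟨n, hn⟩ := exists_nat_gt ((α - (f x).toReal) / (g t x).toReal)
  have hle := h (n : ℝ≥0)
  rw [lagrangian_eq_coe hf hgt hdom hx, EReal.coe_le_coe_iff, NNReal.coe_natCast] at hle
  rw [div_lt_iff₀ hpos'] at hn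
  linarith

theorem iInter_lagrangianSublevel (hf : IsGamma f) (hg : ∀ t ∈ T, IsGamma (g t))
    (hdom : ∀ t ∈ T, effDom f ⊆ effDom (g t)) (hT : T.Nonempty) (hc : c < ⊤) :
    ⋂ i, lagrangianSublevel f T g c i = feasibleSet T g ∩ {x | f x ≤ c} := by
  refine Subset.antisymm (fun x hx => ?_) fun x hx => mem_iInter.2 fun i =>
    (lagrangian_le (hx.1 i.2.1 i.2.1.2)).trans (hx.2.trans i.1.2.le)
  have hle : ∀ α : ℝ, c < α → ∀ t ∈ T, f x ≤ α ∧ g t x ≤ 0 := fun α hα t ht =>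
    le_and_nonpos_of_forall_lagrangian_le hf (hg t ht) (hdom t ht) fun μ =>
      mem_iInter.1 hx (⟨α, hα⟩, ⟨t, ht⟩, μ)
  obtain ⟨t₀, ht₀⟩ := hT
  obtain ⟨β, hβ, -⟩ := EReal.lt_iff_exists_real_btwn.1 hc
  exact ⟨fun t ht => (hle β hβ t ht).2,
    EReal.le_of_forall_lt_iff_le.1 fun α hα => (hle α hα t₀ ht₀).1⟩

theorem iInter_recessionCone_lagrangianSublevel [IsTopologicalAddGroup X] [ContinuousSMul ℝ X]
    (hf : IsGamma f) (hg : ∀ t ∈ T, IsGamma (g t)) (hdom : ∀ t ∈ T, effDom f ⊆ effDom (g t))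
    (hT : T.Nonempty) (hE : (feasibleSet T g ∩ effDom f).Nonempty) (hc : c < ⊤) :
    ⋂ i, recessionCone (lagrangianSublevel f T g c i) = problemRecessionCone f T g := by
  obtain ⟨x₀, hx₀E, hx₀⟩ := hE
  obtain ⟨t₀, ht₀⟩ := hT
  obtain ⟨β, hβ, -⟩ := EReal.lt_iff_exists_real_btwn.1 (max_lt hc hx₀)
  obtain ⟨hcβ, hx₀β⟩ := max_lt_iff.1 hβ
  refine Subset.antisymm (fun d hd => ?_) fun d hd => mem_iInter.2 fun i x hx s hs => ?_
  · have hray : ∀ t ∈ T, ∀ n : ℕ, f (x₀ + (n : ℝ) • d) ≤ β ∧ g t (x₀ + (n : ℝ) • d) ≤ 0 :=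
      fun t ht n => le_and_nonpos_of_forall_lagrangian_le hf (hg t ht) (hdom t ht) fun μ =>
        mem_iInter.1 hd (⟨β, hcβ⟩, ⟨t, ht⟩, μ) x₀
          ((lagrangian_le (hx₀E t ht)).trans hx₀β.le) n n.cast_nonneg
    exact ⟨fun t ht => (hg t ht).recessionFun_nonpos_of_forall_nat (α := 0) fun n =>
      (hray t ht n).2, hf.recessionFun_nonpos_of_forall_nat fun n => (hray t₀ ht₀ n).1⟩
  · have hfd := recessionFun_nonpos_iff.1 hd.2 x s hs
    have hgd := recessionFun_nonpos_iff.1 (hd.1 i.2.1 i.2.1.2) x s hs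
    exact (add_le_add hfd (mul_le_mul_of_nonneg_left hgd (EReal.coe_nonneg.2 i.2.2.2))).trans hx

theorem exists_forall_sum_mul_lagrangian_le [AddCommGroup Z] [Module ℝ Z] (hf : IsGamma f)
    (hg : ∀ t ∈ T, IsGamma (g t)) (hdom : ∀ t ∈ T, effDom f ⊆ effDom (g t)) (hT : Convex ℝ T)
    (hTne : T.Nonempty) (hconc : ∀ x ∈ effDom f, IsConcaveOn T fun t => g t x)
    {κ : Type*} [Fintype κ]
    {w : κ → ℝ} (hw : w ∈ stdSimplex ℝ κ) {t : κ → Z} (ht : ∀ k, t k ∈ T) (μ : κ → ℝ≥0) :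
    ∃ s ∈ T, ∃ ν : ℝ≥0, ∀ x ∈ effDom f,
      ((∑ k, w k * ((f x).toReal + μ k * (g (t k) x).toReal) : ℝ) : EReal) ≤
        lagrangian f g s ν x := by
  have hwμ : ∀ k, 0 ≤ w k * μ k := fun k => mul_nonneg (hw.1 k) (μ k).2
  obtain ⟨s, hs, hle⟩ := exists_mem_forall_sum_mul_le_of_concaveOn hT hTne
    (G := fun (x : effDom f) t => (g t x).toReal) (fun x => (hconc x x.2).concaveOn_toReal hT
      fun t ht => (hg t ht).coe_toReal (hdom t ht x.2)) hwμ ht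
  let ν : ℝ≥0 := (∑ k, w k * μ k).toNNReal
  have hν : (ν : ℝ) = ∑ k, w k * μ k := Real.coe_toNNReal _ (Finset.sum_nonneg fun k _ => hwμ k)
  refine ⟨s, hs, ν, fun x hx => ?_⟩
  rw [lagrangian_eq_coe hf (hg s hs) (hdom s hs) hx, EReal.coe_le_coe_iff, hν]
  calc ∑ k, w k * ((f x).toReal + μ k * (g (t k) x).toReal)
      = (f x).toReal + ∑ k, w k * μ k * (g (t k) x).toReal := by
        simp only [mul_add, Finset.sum_add_distrib, ← Finset.sum_mul, hw.2, one_mul, mul_assoc]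
    _ ≤ (f x).toReal + (∑ k, w k * μ k) * (g s x).toReal := by grw [hle ⟨x, hx⟩]

theorem exists_forall_lagrangian_le [AddCommGroup Z] [Module ℝ Z] (hf : IsGamma f)
    (hg : ∀ t ∈ T, IsGamma (g t)) (hdom : ∀ t ∈ T, effDom f ⊆ effDom (g t)) (hT : Convex ℝ T)
    (hTne : T.Nonempty) (hconc : ∀ x ∈ effDom f, IsConcaveOn T fun t => g t x)
    {κ : Type*} [Finite κ] {t : κ → Z} (ht : ∀ k, t k ∈ T) (μ : κ → ℝ≥0) {α : κ → ℝ}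
    (hα : ∀ k, dualValue f T g < α k) : ∃ x, ∀ k, lagrangian f g (t k) (μ k) x ≤ α k := by
  have := Fintype.ofFinite κ
  let φ : X → κ → ℝ := fun x k => (f x).toReal + μ k * (g (t k) x).toReal - α k
  by_contra! hcon
  have hφ : ConvexOn ℝ (effDom f) φ :=
    ⟨hf.convex_effDom, fun x hx y hy a b ha hb hab k =>
      ((convexOn_toReal_add_mul_toReal hf (hg _ (ht k)) (hdom _ (ht k))).sub
        (concaveOn_const (α k) hf.convex_effDom)).2 hx hy ha hb hab⟩
  have hφ_nonneg : ∀ x ∈ effDom f, ∃ k, 0 ≤ φ x k := fun x hx => by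
    obtain ⟨k, hk⟩ := hcon x
    rw [lagrangian_eq_coe hf (hg _ (ht k)) (hdom _ (ht k)) hx, EReal.coe_lt_coe_iff] at hk
    exact ⟨k, sub_nonneg.2 hk.le⟩
  obtain ⟨w, hw, hwφ⟩ :=
    exists_stdSimplex_forall_sum_mul_nonneg_of_convexOn hφ hf.nonempty_effDom hφ_nonneg
  obtain ⟨s, hs, ν, hle⟩ := exists_forall_sum_mul_lagrangian_le hf hg hdom hT hTne hconc hw ht μ
  have hlt : dualValue f T g < ((∑ k, w k * α k : ℝ) : EReal) := by
    have hconv : Convex ℝ {a : ℝ | dualValue f T g < a} := OrdConnected.convex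
      ⟨fun a ha b _ c hc => lt_of_lt_of_le (mem_ofPred.1 ha) (EReal.coe_le_coe_iff.2 hc.1)⟩
    exact hconv.sum_mem (fun k _ => hw.1 k) hw.2 fun k _ => hα k
  refine hlt.not_ge <| le_trans (le_iInf fun x => ?_) (iInf_lagrangian_le_dualValue hs ν)
  by_cases hx : x ∈ effDom f
  · refine le_trans (EReal.coe_le_coe_iff.2 ?_) (hle x hx)
    simpa [φ, mul_sub, Finset.sum_sub_distrib] using hwφ x hx
  · rw [lagrangian_eq_top ((hg s hs).proper.2 x) hx]
    exact le_top

theorem biInter_lagrangianSublevel_nonempty [AddCommGroup Z] [Module ℝ Z] (hf : IsGamma f)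
    (hg : ∀ t ∈ T, IsGamma (g t)) (hdom : ∀ t ∈ T, effDom f ⊆ effDom (g t)) (hT : Convex ℝ T)
    (hTne : T.Nonempty) (hconc : ∀ x ∈ effDom f, IsConcaveOn T fun t => g t x)
    (F : Finset ({α : ℝ // dualValue f T g < α} × T × ℝ≥0)) :
    (⋂ i ∈ F, lagrangianSublevel f T g (dualValue f T g) i).Nonempty := by
  obtain ⟨x, hx⟩ := exists_forall_lagrangian_le hf hg hdom hT hTne hconc (κ := F)
    (fun i => i.1.2.1.2) (fun i => i.1.2.2) (fun i => i.1.1.2)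
  exact ⟨x, mem_iInter₂.2 fun i hi => hx ⟨i, hi⟩⟩

theorem exists_mem_feasibleSet_le_dualValue [IsTopologicalAddGroup X] [ContinuousSMul ℝ X]
    [LocallyConvexSpace ℝ X] [T2Space X] [AddCommGroup Z] [Module ℝ Z] (hf : IsGamma f)
    (hg : ∀ t ∈ T, IsGamma (g t)) (hE : (feasibleSet T g ∩ effDom f).Nonempty)
    (hdom : ∀ t ∈ T, effDom f ⊆ effDom (g t)) (hT : Convex ℝ T)
    (hconc : ∀ x ∈ effDom f, IsConcaveOn T fun t => g t x)
    (hloc : ∃ t ∈ T, ∃ μ : ℝ≥0, WeaklyInfLocallyCompact (lagrangian f g t μ))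
    (L : Submodule ℝ X) (hL : (L : Set X) = problemRecessionCone f T g) :
    ∃ x ∈ feasibleSet T g, f x ≤ dualValue f T g := by
  obtain ⟨t₀, ht₀, μ₀, hcompact⟩ := hloc
  have hTne : T.Nonempty := ⟨t₀, ht₀⟩
  have hlt : dualValue f T g < ⊤ := hE.elim fun x hx => (dualValue_le hx.1).trans_lt hx.2
  obtain ⟨β, hβ, -⟩ := EReal.lt_iff_exists_real_btwn.1 hlt
  let A := lagrangianSublevel f T g (dualValue f T g)
  have hclosed : ∀ i, IsClosed (A i) := fun i =>
    (lowerSemicontinuous_lagrangian hf (hg _ i.2.1.2)).isClosed_preimage _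
  have hconvex : ∀ i, Convex ℝ (A i) := fun i =>
    convex_lagrangian_le hf (hg _ i.2.1.2) (hdom _ i.2.1.2) _
  let i₀ : {α : ℝ // dualValue f T g < α} × T × ℝ≥0 := (⟨β, hβ⟩, ⟨t₀, ht₀⟩, μ₀)
  have : LocallyCompactSpace ↥(toWeakSpace ℝ X '' A i₀) := hcompact β
  have hcone : (L : Set X) = ⋂ i, recessionCone (A i) :=
    hL.trans (iInter_recessionCone_lagrangianSublevel hf hg hdom hTne hE hlt).symm
  have hne := nonempty_iInter_of_iInter_recessionCone_eq hclosed hconvex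
    (biInter_lagrangianSublevel_nonempty hf hg hdom hT hTne hconc) i₀ L hcone
  rwa [iInter_lagrangianSublevel hf hg hdom hTne hlt] at hne

end Lagrangian

end ReverseDuality

open ReverseDuality in
theorem corollary5_general
    {X : Type*} [AddCommGroup X] [Module ℝ X] [TopologicalSpace X] [IsTopologicalAddGroup X]
    [ContinuousSMul ℝ X] [LocallyConvexSpace ℝ X] [T2Space X]
    {Z : Type*} [AddCommGroup Z] [Module ℝ Z] (T : Set Z) (f : X → EReal) (g : Z → X → EReal)
    (hf : IsGamma f) (hg : ∀ t ∈ T, IsGamma (g t))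
    (hE : (feasibleSet T g ∩ effDom f).Nonempty) (ha : effDom f ⊆ ⋂ t ∈ T, effDom (g t))
    (hb_convex : Convex ℝ T) (hc_concave : ∀ x ∈ effDom f, IsConcaveOn T fun t => g t x)
    (hd : ∃ t ∈ T, ∃ μ : ℝ≥0, WeaklyInfLocallyCompact (lagrangian f g t μ))
    (he : ∃ L : Submodule ℝ X, (L : Set X) = problemRecessionCone f T g) :
    ∃ r : ℝ, IsLeast (f '' feasibleSet T g) (r : EReal) ∧
      (⨆ p : T × ℝ≥0, ⨅ x : X, lagrangian f g p.1 p.2 x) = (r : EReal) := by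
  obtain ⟨L, hL⟩ := he
  have hdom : ∀ t ∈ T, effDom f ⊆ effDom (g t) := Set.subset_iInter₂_iff.1 ha
  obtain ⟨x, hx, hle⟩ :=
    exists_mem_feasibleSet_le_dualValue hf hg hE hdom hb_convex hc_concave hd L hL
  have hmin : ∀ y ∈ feasibleSet T g, f x ≤ f y := fun y hy => hle.trans (dualValue_le hy)
  have hfx : ((f x).toReal : EReal) = f x :=
    hf.coe_toReal (hE.elim fun y hy => (hmin y hy.1).trans_lt hy.2)
  refine ⟨(f x).toReal, ?_, ?_⟩ <;> rw [hfx]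
  · exact ⟨Set.mem_image_of_mem f hx, Set.forall_mem_image.2 hmin⟩
  · exact (dualValue_le hx).antisymm hle

theorem corollary5
    {X : Type*} [AddCommGroup X] [Module ℝ X] [TopologicalSpace X] [IsTopologicalAddGroup X]
    [ContinuousSMul ℝ X] [LocallyConvexSpace ℝ X] [T2Space X]
    {Z : Type*} [AddCommGroup Z] [Module ℝ Z] [TopologicalSpace Z] [IsTopologicalAddGroup Z]
    [ContinuousSMul ℝ Z] [LocallyConvexSpace ℝ Z]
    (T : Set Z) (f : X → EReal) (g : Z → X → EReal)
    (hf : ReverseDuality.IsGamma f)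
    (hg : ∀ t ∈ T, ReverseDuality.IsGamma (g t))
    (hE : (ReverseDuality.feasibleSet T g ∩ ReverseDuality.effDom f).Nonempty)
    (ha : ReverseDuality.effDom f ⊆ ⋂ t ∈ T, ReverseDuality.effDom (g t))
    (hb_convex : Convex ℝ T) (hb_compact : IsCompact T)
    (hc_concave : ∀ x ∈ ⋂ t ∈ T, ReverseDuality.effDom (g t),
      ReverseDuality.IsConcaveOn T (fun t => g t x))
    (hc_usc : ∀ x ∈ ⋂ t ∈ T, ReverseDuality.effDom (g t),
      UpperSemicontinuousOn (fun t => g t x) T)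
    (hd : ∃ t ∈ T, ∃ μ : ℝ≥0,
      ReverseDuality.WeaklyInfLocallyCompact (ReverseDuality.lagrangian f g t μ))
    (he : ∃ L : Submodule ℝ X, (L : Set X) = ReverseDuality.problemRecessionCone f T g) :
    ∃ r : ℝ,
      IsLeast (f '' ReverseDuality.feasibleSet T g) (r : EReal) ∧
      (⨆ p : T × ℝ≥0, ⨅ x : X, ReverseDuality.lagrangian f g p.1 p.2 x) = (r : EReal) := by
  exact corollary5_general T f g hf hg hE ha hb_convex (fun x hx => hc_concave x (ha hx)) hd he
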